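/- Let $G=(V,E)$ be a locally finite simple graph with countable vertex set $V$ (not necessarily connected), and let $s\colon E\to\{-1,1\}$ assign a sign to every edge. Write $d(x)$ for the degree of $x$ and, for $\eta\in\{-1,1\}^V$, let $\eta^x$ be the configuration that agrees with $\eta$ except that the spin at $x$ is reversed. The signed voter model $(\eta_t)_{t\ge 0}$ on $(G,s)$ is the spin system on $\{-1,1\}^V$ with operator $$\Omega f(\eta)=\sum_{x\in V}\bigl(f(\eta^x)-f(\eta)\bigr)\,\frac1{d(x)}\sum_{y\colon\{x,y\}\in E}\mathbf 1\{\eta(x)\eta(y)\neq s(\{x,y\})\},$$ that is, the Feller process on $\{-1,1\}^V$ (with the product topology) whose infinitesimal generator is given by $\Omega$ on functions $f$ that depend on finitely many spins (isolated vertices never flip). An equilibrium is a probability measure on $\{-1,1\}^V$ that is invariant for this process. The process is called ergodic if it has a unique equilibrium $\mu$ and, for every initial configuration $\eta_0\in\{-1,1\}^V$, the law of $\eta_t$ converges weakly to $\mu$ as $t\to\infty$. If the signed voter model on $(G,s)$ has a unique equilibrium, then it is ergodic. -/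

import Mathlib

open MeasureTheory ProbabilityTheory Filter Topology
open scoped NNReal

/-! ### Configurations -/

/-- The spin space `{-1, 1}` is `ℤˣ`; a configuration is an element of `{-1, 1}^V`, with the
product topology and the product σ-algebra. -/
abbrev SpinConfig (V : Type*) : Type _ := V → ℤˣ

/-- The σ-algebra of the (finite, discrete) spin space is its Borel σ-algebra. -/
instance instBorelSpaceSpin : BorelSpace ℤˣ := by
  have h : ∀ s : Set ℤˣ, MeasurableSet s := fun s =>
    ⟨Units.val '' s, MeasurableSet.of_discrete, Set.preimage_image_eq s Units.val_injective⟩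
  refine ⟨?_⟩
  ext s
  refine ⟨fun _ => ?_, fun _ => h s⟩
  exact MeasurableSpace.measurableSet_generateFrom (isOpen_discrete s)

/-- The configuration `η^x`, which equals `η` except that the spin at `x` is reversed. -/
noncomputable def SpinConfig.flip {V : Type*} (η : SpinConfig V) (x : V) : SpinConfig V := by
  classical exact Function.update η x (-η x)

/-- Cylinder functions: real functions of the configuration that depend on finitely many
spins only. -/
def IsCylinder {V : Type*} (f : SpinConfig V → ℝ) : Prop :=
  ∃ A : Finset V, DependsOn f (A : Set V)

/-! ### Feller processes, through their transition kernels -/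

/-- A (conservative) Feller process on `X`, given by its transition probabilities: `P t x` is the
law at time `t` of the process started from `x`. -/
structure FellerProcess (X : Type*) [TopologicalSpace X] [MeasurableSpace X] where
  /-- The transition kernels. -/
  P : ℝ≥0 → Kernel X X
  /-- Each `P t x` is a probability measure. -/
  isMarkovKernel : ∀ t, IsMarkovKernel (P t)
  /-- The process starts where it is told to start. -/
  P_zero : P 0 = Kernel.id
  /-- The Chapman-Kolmogorov equations (Markov property). -/
  P_add : ∀ t u, P (t + u) = P u ∘ₖ P t
  /-- The semigroup maps continuous functions to continuous functions. -/
  continuous_P : ∀ (t : ℝ≥0) (f : C(X, ℝ)), Continuous fun x => ∫ y, f y ∂(P t x)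
  /-- Strong continuity of the semigroup at time `0`. -/
  tendsto_P : ∀ f : C(X, ℝ),
    TendstoUniformly (fun (t : ℝ≥0) x => ∫ y, f y ∂(P t x)) f (𝓝[>] 0)

namespace FellerProcess

variable {X : Type*} [TopologicalSpace X] [MeasurableSpace X]

instance instIsMarkovKernel (Φ : FellerProcess X) (t : ℝ≥0) : IsMarkovKernel (Φ.P t) :=
  Φ.isMarkovKernel t

/-- `f` is in the domain of the infinitesimal generator, and the generator maps `f` to `g`:
`(P_t f - f) / t` converges to `g` uniformly as `t ↓ 0`. -/
def HasGenerator (Φ : FellerProcess X) (f g : X → ℝ) : Prop :=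
  TendstoUniformly (fun (t : ℝ≥0) x => ((∫ y, f y ∂(Φ.P t x)) - f x) / (t : ℝ)) g (𝓝[>] 0)

/-- The law at time `t` of the process started from `x`. -/
noncomputable def law (Φ : FellerProcess X) (t : ℝ≥0) (x : X) : ProbabilityMeasure X :=
  ⟨Φ.P t x, inferInstance⟩

/-- An equilibrium: a probability measure that is invariant for the process. -/
def IsEquilibrium (Φ : FellerProcess X) (μ : ProbabilityMeasure X) : Prop :=
  ∀ t, Kernel.Invariant (Φ.P t) (μ : Measure X)

/-- Ergodicity: there is a unique equilibrium `μ`, and for every initial state the law at time `t`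
converges weakly to `μ` as `t → ∞`. -/
def IsErgodic [OpensMeasurableSpace X] (Φ : FellerProcess X) : Prop :=
  ∃ μ : ProbabilityMeasure X, (Φ.IsEquilibrium μ ∧ ∀ ν, Φ.IsEquilibrium ν → ν = μ) ∧
    ∀ x, Tendsto (fun t => Φ.law t x) atTop (𝓝 μ)

end FellerProcess

/-! ### The signed voter model -/

namespace SignedVoter

variable {V : Type*} (G : SimpleGraph V) [G.LocallyFinite] (sgn : G.edgeSet → ℤˣ)

/-- The rate at which the spin at `x` flips in the configuration `η`:
`(1 / d(x)) ∑_{y ~ x} 1{η(x) η(y) ≠ sgn {x, y}}` (it is `0` at an isolated vertex). -/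
noncomputable def flipRate (η : SpinConfig V) (x : V) : ℝ :=
  (1 / (G.degree x : ℝ)) *
    ∑ y : G.neighborSet x,
      if η x * η y ≠ sgn ⟨s(x, (y : V)), G.mem_edgeSet.2 y.2⟩ then (1 : ℝ) else 0

/-- The operator `Ω f (η) = ∑_x (f (η^x) - f η) * flipRate η x`. For a cylinder function `f` only
finitely many terms of the sum are nonzero. -/
noncomputable def Ω (f : SpinConfig V → ℝ) (η : SpinConfig V) : ℝ :=
  ∑' x : V, (f (η.flip x) - f η) * flipRate G sgn η x

/-- `Φ` is the signed voter model on the graph `G` with signs `sgn`: the spin system on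
`{-1, 1}^V` with operator `Ω`, i.e. the Feller process whose generator is given by `Ω` on cylinder
functions. (Since cylinder functions are a core, this is the same as saying that the generator is
the closure of `Ω` on cylinder functions, and it determines the process.) -/
def IsSignedVoterModel (Φ : FellerProcess (SpinConfig V)) : Prop :=
  ∀ f : SpinConfig V → ℝ, IsCylinder f → Φ.HasGenerator f (Ω G sgn f)

end SignedVoter

/-!
The argument shows that the laws of `η_t` and `η_{t+s}` merge as `t → ∞`, for every initial
configuration and every `s`; uniqueness of the equilibrium then forces convergence.

Duality. The expectations `u_A(t)` of the spin products `∏_{x ∈ A} η_t(x)` solve the linear system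
`u' = L u`, in which `L` (`SignedVoter.dualGen`) is a signed version of the generator of annihilating
random walks (`SignedVoter.Ω_spinProd`). The number of walkers never increases, so the system closes
on the sets with at most `n` elements, and there `‖L + n‖ ≤ n` in the supremum norm
(`SignedVoter.abs_dualGen_add_le`).

Decay. A bounded solution of a linear system with this property satisfies `‖u'(t)‖ → 0`
(`exists_forall_abs_deriv_le_of_bounded`). Equivalently, `L = n (K - 1)` with `‖K‖ ≤ 1`, and
`exp (t L)` is an average of the powers of `K` over a Poisson law of mean `n t`; a small shift of the
mean hardly changes this law in total variation when `t` is large. The proof given here is a direct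
one by differential inequalities. Consequently `u_A(t + s) - u_A(t) → 0`.

Conclusion. By the Stone-Weierstrass theorem, `P_{t+s} f(η) - P_t f(η) → 0` for every continuous `f`.
By the Feller property, every limit point of the law of `η_t` is therefore an equilibrium. If there
is only one equilibrium, compactness of the space of probability measures gives convergence
(`FellerProcess.isErgodic_of_isAsymptoticallyInvariant`).
-/

/-! ### A decay estimate for linear systems with bounded rates -/

/-- Let `u' = v` and `v' = w`, where `w ≤ N (c - v)`. The deficit `c - v` then decreases at most at
exponential rate `N`, so if it is at most `δ` at the end of an interval of length `h`, it is at most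
`exp (N h) δ` throughout, and `u` has grown by at least `h (c - exp (N h) δ)`. -/
theorem mul_le_sub_of_deriv_right_le {u v w : ℝ → ℝ} {a h c δ N : ℝ} (hh : 0 ≤ h) (hN : 0 ≤ N)
    (hδ : 0 ≤ δ) (huc : ContinuousOn u (Set.Icc a (a + h)))
    (hvc : ContinuousOn v (Set.Icc a (a + h)))
    (hu : ∀ t ∈ Set.Ico a (a + h), HasDerivWithinAt u (v t) (Set.Ici t) t)
    (hv : ∀ t ∈ Set.Ico a (a + h), HasDerivWithinAt v (w t) (Set.Ici t) t)
    (hw : ∀ t ∈ Set.Ico a (a + h), w t + N * v t ≤ N * c) (hend : c - δ ≤ v (a + h)) :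
    h * (c - Real.exp (N * h) * δ) ≤ u (a + h) - u a := by
  have key : ∀ t ∈ Set.Icc a (a + h), c - Real.exp (N * h) * δ ≤ v t := by
    intro t ht
    have hmono := image_le_of_deriv_right_le_deriv_boundary
      (f := fun r => Real.exp (N * r) * (v r - c))
      (f' := fun r => Real.exp (N * r) * N * (v r - c) + Real.exp (N * r) * w r)
      (B := fun _ => Real.exp (N * t) * (v t - c)) (B' := fun _ => 0) (a := t) (b := a + h)
      (by
        have := hvc.mono (Set.Icc_subset_Icc_left ht.1)
        fun_prop)
      (fun r hr => by
        have h1 : HasDerivAt (fun r => Real.exp (N * r)) (Real.exp (N * r) * N) r := by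
          simpa using ((hasDerivAt_id r).const_mul N).exp
        exact h1.hasDerivWithinAt.mul ((hv r ⟨ht.1.trans hr.1, hr.2⟩).sub_const c))
      le_rfl continuousOn_const (fun r _ => hasDerivWithinAt_const _ _ _)
      (fun r hr => by
        have := hw r ⟨ht.1.trans hr.1, hr.2⟩
        have h2 : w r + N * (v r - c) ≤ 0 := by linarith
        have := mul_nonpos_of_nonneg_of_nonpos (Real.exp_pos (N * r)).le h2
        linarith)
      (Set.right_mem_Icc.2 ht.2)
    have h3 : Real.exp (N * (a + h)) = Real.exp (N * t) * Real.exp (N * (a + h - t)) := by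
      rw [← Real.exp_add]; congr 1; ring
    simp only [h3, mul_assoc] at hmono
    have h4 := le_of_mul_le_mul_left hmono (Real.exp_pos _)
    have h5 : Real.exp (N * (a + h - t)) ≤ Real.exp (N * h) :=
      Real.exp_le_exp.2 (mul_le_mul_of_nonneg_left (by linarith [ht.1]) hN)
    have h6 : Real.exp (N * (a + h - t)) * (-δ) ≤ Real.exp (N * (a + h - t)) * (v (a + h) - c) :=
      mul_le_mul_of_nonneg_left (by linarith) (Real.exp_pos _).le
    have h7 := mul_le_mul_of_nonneg_right h5 hδ
    linarith
  have hlin := image_le_of_deriv_right_le_deriv_boundary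
    (f := fun r => u a + (r - a) * (c - Real.exp (N * h) * δ))
    (f' := fun _ => c - Real.exp (N * h) * δ) (B := u) (B' := v) (a := a) (b := a + h)
    (by fun_prop)
    (fun r _ => by
      simpa using ((((hasDerivAt_id r).sub_const a).mul_const
        (c - Real.exp (N * h) * δ)).const_add (u a)).hasDerivWithinAt)
    (by simp) huc hu (fun r hr => key r ⟨hr.1, hr.2.le⟩)
    (Set.right_mem_Icc.2 (by linarith))
  simp only [add_sub_cancel_left] at hlin
  linarith

/-- Let `u` be a bounded solution of a linear system `u' = v`, `v' = w`, where `w + N v` is bounded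
by `N` times the supremum of `v`. Then `v` tends to `0` uniformly in the index. Indeed, if the limit
superior `a` of the supremum norm of `v` were positive, there would be an index `i` and a late time
at which `v i` is nearly extremal; then `v i` was nearly extremal during a whole long interval
before that time, and `u i` changed over it by more than its bound permits. -/
theorem exists_forall_abs_deriv_le_of_bounded {ι : Type*} {u v w : ι → ℝ → ℝ} {N C : ℝ}
    (hN : 0 ≤ N)
    (huc : ∀ i, ContinuousOn (u i) (Set.Ici 0)) (hvc : ∀ i, ContinuousOn (v i) (Set.Ici 0))
    (hu : ∀ i t, 0 ≤ t → HasDerivWithinAt (u i) (v i t) (Set.Ici t) t)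
    (hv : ∀ i t, 0 ≤ t → HasDerivWithinAt (v i) (w i t) (Set.Ici t) t)
    (hub : ∀ i t, |u i t| ≤ 1) (hvb : ∀ i t, |v i t| ≤ C)
    (hw : ∀ t c, (∀ j, |v j t| ≤ c) → ∀ i, |w i t + N * v i t| ≤ N * c) {ε : ℝ} (hε : 0 < ε) :
    ∃ T, 0 ≤ T ∧ ∀ t, T ≤ t → ∀ i, |v i t| ≤ ε := by
  by_contra hcon
  -- `a` is the limit superior, as `t → ∞`, of the supremum over `i` of `|v i t|`.
  set S : Set ℝ := {c | 0 < c ∧ ∃ T, 0 ≤ T ∧ ∀ t, T ≤ t → ∀ i, |v i t| ≤ c}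
  set a := sInf S
  have hbdd : BddBelow S := ⟨0, fun c hc => hc.1.le⟩
  have hne : S.Nonempty :=
    ⟨max C 1, by positivity, 0, le_rfl, fun t _ i => (hvb i t).trans (le_max_left _ _)⟩
  have hεa : ε ≤ a := by
    refine le_csInf hne fun c hc => ?_
    by_contra! hlt
    obtain ⟨-, T, hT, hTc⟩ := hc
    exact hcon ⟨T, hT, fun t ht i => (hTc t ht i).trans hlt.le⟩
  have ha0 : 0 < a := hε.trans_le hεa
  -- Growth at speed at least `a / 2` over an interval of length `h = 5 / a` exceeds the greatest
  -- possible increment `2` of `u i`; `δ` is such that `c - exp (N h) δ ≥ a / 2` whenever `a ≤ c`.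
  set h : ℝ := 5 / a with hh
  have hh0 : 0 < h := by positivity
  set δ : ℝ := a / 2 * Real.exp (-(N * h)) with hδ
  have hδ0 : 0 < δ := by positivity
  have hδa : δ < a := by
    have : Real.exp (-(N * h)) ≤ 1 := Real.exp_le_one_iff.2 (by nlinarith)
    nlinarith
  obtain ⟨c, hcS, hca⟩ := exists_lt_of_csInf_lt hne (show a < a + δ / 2 by linarith)
  have hac : a ≤ c := csInf_le hbdd hcS
  obtain ⟨hc0, T, hT0, hT⟩ := hcS
  -- As `c - δ < a`, the value `c - δ` is still exceeded after time `T + h`.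
  have hnot : c - δ ∉ S := fun hmem => by
    have := csInf_le hbdd hmem
    linarith
  have : ∃ t, T + h ≤ t ∧ ∃ i, c - δ < |v i t| := by
    by_contra! hcon'
    exact hnot ⟨by linarith, T + h, by linarith, fun t ht i => hcon' t ht i⟩
  obtain ⟨t, ht, i, hi⟩ := this
  have hs0 : 0 ≤ t - h := by linarith
  have hsub : Set.Icc (t - h) (t - h + h) ⊆ Set.Ici 0 := fun r hr => hs0.trans hr.1
  have hwc : ∀ r ∈ Set.Ico (t - h) (t - h + h), |w i r + N * v i r| ≤ N * c := fun r hr =>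
    hw r c (hT r (by linarith [hr.1])) i
  have hgain : h * (c - Real.exp (N * h) * δ) ≤ |u i (t - h + h) - u i (t - h)| := by
    rcases le_abs.1 hi.le with hpos | hneg
    · exact (mul_le_sub_of_deriv_right_le hh0.le hN hδ0.le ((huc i).mono hsub)
        ((hvc i).mono hsub) (fun r hr => hu i r (hs0.trans hr.1))
        (fun r hr => hv i r (hs0.trans hr.1)) (fun r hr => (abs_le.1 (hwc r hr)).2)
        (by simpa using hpos)).trans (le_abs_self _)
    · refine (mul_le_sub_of_deriv_right_le (u := -u i) (v := -v i) (w := fun r => -w i r)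
        hh0.le hN hδ0.le ((huc i).mono hsub).neg
        ((hvc i).mono hsub).neg (fun r hr => (hu i r (hs0.trans hr.1)).neg)
        (fun r hr => (hv i r (hs0.trans hr.1)).neg)
        (fun r hr => ?_) (by simpa using hneg)).trans ?_
      · have := (abs_le.1 (hwc r hr)).1
        simp only [Pi.neg_apply]; linarith
      · rw [Pi.neg_apply, Pi.neg_apply, neg_sub_neg, abs_sub_comm]
        exact le_abs_self _
  have hdiff : |u i (t - h + h) - u i (t - h)| ≤ 2 := by
    have := abs_sub (u i (t - h + h)) (u i (t - h))
    linarith [hub i (t - h + h), hub i (t - h)]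
  have hδe : Real.exp (N * h) * δ = a / 2 := by
    rw [hδ, mul_left_comm, ← Real.exp_add]; simp
  have hha : h * a = 5 := by rw [hh]; field_simp
  rw [hδe] at hgain
  nlinarith [mul_le_mul_of_nonneg_left hac hh0.le]

/-! ### Feller semigroups -/

namespace FellerProcess

variable {X : Type*} [TopologicalSpace X] [MeasurableSpace X] [CompactSpace X]
  [OpensMeasurableSpace X]

theorem integrable_continuousMap (μ : Measure X) [IsFiniteMeasure μ] (f : C(X, ℝ)) :
    Integrable f μ :=
  (BoundedContinuousFunction.mkOfCompact f).integrable μ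

/-- The Feller semigroup on continuous functions: `Φ.semigroup t f x` is the expectation of `f` at
time `t` for the process started from `x`. -/
noncomputable def semigroup (Φ : FellerProcess X) (t : ℝ≥0) : C(X, ℝ) →ₗ[ℝ] C(X, ℝ) where
  toFun f := ⟨fun x => ∫ y, f y ∂(Φ.P t x), Φ.continuous_P t f⟩
  map_add' f g := ContinuousMap.ext fun _ =>
    integral_add (integrable_continuousMap _ f) (integrable_continuousMap _ g)
  map_smul' a f := ContinuousMap.ext fun _ => integral_const_mul a f

theorem semigroup_apply (Φ : FellerProcess X) (t : ℝ≥0) (f : C(X, ℝ)) (x : X) :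
    Φ.semigroup t f x = ∫ y, f y ∂(Φ.P t x) := rfl

theorem semigroup_add (Φ : FellerProcess X) (t s : ℝ≥0) (f : C(X, ℝ)) :
    Φ.semigroup (t + s) f = Φ.semigroup t (Φ.semigroup s f) := by
  ext x
  have h := Φ.P_add t s
  rw [semigroup_apply, h, Kernel.integral_comp]
  · rfl
  · rw [← h]; exact integrable_continuousMap _ f

theorem abs_semigroup_apply_le (Φ : FellerProcess X) (t : ℝ≥0) {f : C(X, ℝ)} {c : ℝ}
    (h : ∀ y, |f y| ≤ c) (x : X) : |Φ.semigroup t f x| ≤ c := by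
  simpa using! norm_integral_le_of_norm_le_const (μ := Φ.P t x) (f := f) (ae_of_all _ h)

theorem abs_semigroup_sub_le (Φ : FellerProcess X) (t : ℝ≥0) {f g : C(X, ℝ)} {c : ℝ}
    (h : ∀ y, |f y - g y| ≤ c) (x : X) :
    |Φ.semigroup t f x - Φ.semigroup t g x| ≤ c := by
  rw [← ContinuousMap.sub_apply, ← map_sub]
  exact Φ.abs_semigroup_apply_le t h x

theorem continuousOn_semigroup (Φ : FellerProcess X) (f : C(X, ℝ)) (x : X) :
    ContinuousOn (fun t : ℝ => Φ.semigroup t.toNNReal f x) (Set.Ici 0) := by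
  rw [Metric.continuousOn_iff]
  intro t ht ε hε
  have h := Metric.tendstoUniformly_iff.1 (Φ.tendsto_P f) (ε / 2) (by positivity)
  obtain ⟨r, hr, hr'⟩ := mem_nhdsGT_iff_exists_Ioo_subset.1 h
  -- The identity `P_b f - P_a f = P_a (P_(b-a) f - f)` reduces continuity
  -- at any time, from both sides, to uniform convergence `P_h f → f` as `h ↓ 0`.
  have key : ∀ a b : ℝ≥0, a < b → b < a + r →
      |Φ.semigroup b f x - Φ.semigroup a f x| ≤ ε / 2 := by
    intro a b hab hbr
    have hmem : b - a ∈ Set.Ioo 0 r := ⟨tsub_pos_of_lt hab, by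
      rw [tsub_lt_iff_left hab.le]; exact hbr⟩
    have hd : ∀ y, |Φ.semigroup (b - a) f y - f y| ≤ ε / 2 := fun y => by
      have := hr' hmem y
      rw [dist_comm] at this
      exact this.le
    have := Φ.abs_semigroup_sub_le a hd x
    rwa [← semigroup_add, add_tsub_cancel_of_le hab.le] at this
  refine ⟨r, hr, fun t' ht' hd => ?_⟩
  lift t to ℝ≥0 using ht
  lift t' to ℝ≥0 using ht'
  rw [Real.dist_eq, abs_lt] at hd
  simp only [Real.toNNReal_coe, Real.dist_eq]
  rcases lt_trichotomy t t' with hlt | rfl | hlt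
  · have h2 : t' < t + r := by rw [← NNReal.coe_lt_coe, NNReal.coe_add]; linarith [hd.2]
    linarith [key t t' hlt h2]
  · simpa using hε
  · have h2 : t < t' + r := by rw [← NNReal.coe_lt_coe, NNReal.coe_add]; linarith [hd.1]
    rw [abs_sub_comm]
    linarith [key t' t hlt h2]

/-- If the generator maps `f` to `g`, then `t ↦ Pₜ f` has right derivative `Pₜ g` at every time. -/
theorem HasGenerator.hasDerivWithinAt {Φ : FellerProcess X} {f g : C(X, ℝ)}
    (h : Φ.HasGenerator f g) (x : X) {t : ℝ} (ht : 0 ≤ t) :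
    HasDerivWithinAt (fun r : ℝ => Φ.semigroup r.toNNReal f x) (Φ.semigroup t.toNNReal g x)
      (Set.Ici t) t := by
  rw [← hasDerivWithinAt_Ioi_iff_Ici, hasDerivWithinAt_iff_tendsto_slope'
    (by simp : t ∉ Set.Ioi t), Metric.tendsto_nhds]
  intro ε hε
  have hu := Metric.tendstoUniformly_iff.1 h (ε / 2) (by positivity)
  obtain ⟨r, hr, hr'⟩ := mem_nhdsGT_iff_exists_Ioo_subset.1 hu
  have hr0 : (0 : ℝ) < r := hr
  filter_upwards [Ioo_mem_nhdsGT (show t < t + r by linarith)] with b hb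
  lift t to ℝ≥0 using ht
  lift b to ℝ≥0 using t.2.trans hb.1.le
  have htb : t < b := NNReal.coe_lt_coe.1 hb.1
  have hbr : b < t + r := by exact_mod_cast hb.2
  have hmem : b - t ∈ Set.Ioo 0 r := ⟨tsub_pos_of_lt htb, by
    rw [tsub_lt_iff_left htb.le]; exact hbr⟩
  have hd : ∀ y, |(((b - t : ℝ≥0) : ℝ)⁻¹ • (Φ.semigroup (b - t) f - f)) y - g y| ≤ ε / 2 :=
    fun y => by
      have := hr' hmem y
      rw [dist_comm, div_eq_inv_mul] at this
      exact this.le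
  have := Φ.abs_semigroup_sub_le t hd x
  rw [map_smul, map_sub, ← semigroup_add, add_tsub_cancel_of_le htb.le] at this
  rw [Real.dist_eq, slope_def_module]
  simp only [Real.toNNReal_coe]
  rw [NNReal.coe_sub htb.le] at this
  exact this.trans_lt (by linarith)

/-- The function `f` is asymptotically invariant: for every starting point and every `s`, its
expectations at times `t` and `t + s` become indistinguishable as `t → ∞`. -/
def IsAsymptoticallyInvariant (Φ : FellerProcess X) (f : C(X, ℝ)) : Prop :=
  ∀ (s : ℝ≥0) (x : X),
    Tendsto (fun t => Φ.semigroup (t + s) f x - Φ.semigroup t f x) atTop (𝓝 0)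

theorem IsAsymptoticallyInvariant.of_mem_span {Φ : FellerProcess X} {S : Set C(X, ℝ)}
    (hS : ∀ f ∈ S, Φ.IsAsymptoticallyInvariant f) {f : C(X, ℝ)} (hf : f ∈ Submodule.span ℝ S) :
    Φ.IsAsymptoticallyInvariant f := by
  induction hf using Submodule.span_induction with
  | mem f hf => exact hS f hf
  | zero => intro s x; simp
  | add f g _ _ hf hg =>
    intro s x
    have := (hf s x).add (hg s x)
    rw [add_zero] at this
    refine this.congr fun t => ?_
    simp only [map_add, ContinuousMap.add_apply]
    ring
  | smul a f _ hf =>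
    intro s x
    have := (hf s x).const_mul a
    rw [mul_zero] at this
    refine this.congr fun t => ?_
    simp only [map_smul, ContinuousMap.smul_apply, smul_eq_mul]
    ring

theorem IsAsymptoticallyInvariant.of_mem_closure {Φ : FellerProcess X} {S : Set C(X, ℝ)}
    (hS : ∀ f ∈ S, Φ.IsAsymptoticallyInvariant f) {f : C(X, ℝ)} (hf : f ∈ closure S) :
    Φ.IsAsymptoticallyInvariant f := by
  intro s x
  rw [Metric.tendsto_nhds]
  intro ε hε
  obtain ⟨g, hg, hfg⟩ := Metric.mem_closure_iff.1 hf (ε / 3) (by positivity)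
  have hfg' : ∀ y, |f y - g y| ≤ ε / 3 := fun y =>
    (ContinuousMap.dist_apply_le_dist (f := f) (g := g) y).trans hfg.le
  filter_upwards [Metric.tendsto_nhds.1 (hS g hg s x) (ε / 3) (by positivity)] with t ht
  have h1 := Φ.abs_semigroup_sub_le t hfg' x
  have h2 := Φ.abs_semigroup_sub_le (t + s) hfg' x
  rw [Real.dist_0_eq_abs] at ht ⊢
  rw [abs_le] at h1 h2
  rw [abs_lt] at ht ⊢
  constructor <;> linarith

/-- A limit point `ν` of the laws at time `t` satisfies `∫ Pₛ f dν = ∫ f dν` if `f` is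
asymptotically invariant, since `Pₛ f` is continuous. If this holds for all `f`, every limit point
is an equilibrium, and compactness of the space of probability measures gives convergence. -/
theorem isErgodic_of_isAsymptoticallyInvariant [HasOuterApproxClosed X] [BorelSpace X]
    [CompactSpace (ProbabilityMeasure X)]
    (Φ : FellerProcess X) (hinv : ∀ f, Φ.IsAsymptoticallyInvariant f)
    (hunique : ∃! μ : ProbabilityMeasure X, Φ.IsEquilibrium μ) : Φ.IsErgodic := by
  obtain ⟨μ, hμ, huniq⟩ := hunique
  refine ⟨μ, ⟨hμ, huniq⟩, fun x => tendsto_nhds_of_unique_mapClusterPt fun ν hν => huniq ν ?_⟩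
  intro s
  obtain ⟨U, hU, hUν⟩ := mapClusterPt_iff_ultrafilter.1 hν
  have hlim : ∀ f : C(X, ℝ), Tendsto (fun t => Φ.semigroup t f x) U (𝓝 (∫ y, f y ∂ν)) := fun f =>
    ProbabilityMeasure.tendsto_iff_forall_integral_tendsto.1 hUν
      (BoundedContinuousFunction.mkOfCompact f)
  rw [Kernel.Invariant]
  refine ext_of_forall_integral_eq_of_IsFiniteMeasure fun f => ?_
  have hcomp : ∫ y, f y ∂((ν : Measure X).bind (Φ.P s)) =
      ∫ y, Φ.semigroup s f.toContinuousMap y ∂ν :=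
    Kernel.integral_comp (η := Φ.P s) (κ := Kernel.const Unit (ν : Measure X)) (a := ())
      (integrable_continuousMap ((Φ.P s ∘ₖ Kernel.const Unit (ν : Measure X)) ())
        f.toContinuousMap)
  rw [hcomp]
  have h1 := hlim (Φ.semigroup s f.toContinuousMap)
  simp only [← semigroup_add] at h1
  have h2 := h1.sub (hlim f.toContinuousMap)
  exact sub_eq_zero.1 (tendsto_nhds_unique h2 ((hinv f.toContinuousMap s x).mono_left hU))

end FellerProcess

/-! ### Spin products and their duality -/

namespace SignedVoter

variable {V : Type*}

/-- The product of the spins in the finite set `A`. -/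
noncomputable def spinProd (A : Finset V) : C(SpinConfig V, ℝ) where
  toFun η := ∏ x ∈ A, ((η x : ℤ) : ℝ)
  continuous_toFun := continuous_finsetProd _ fun x _ =>
    (continuous_of_discreteTopology (f := fun e : ℤˣ => ((e : ℤ) : ℝ))).comp (continuous_apply x)

theorem spinProd_apply (A : Finset V) (η : SpinConfig V) :
    spinProd A η = ∏ x ∈ A, ((η x : ℤ) : ℝ) := rfl

theorem abs_spinProd (A : Finset V) (η : SpinConfig V) : |spinProd A η| = 1 := by
  rw [spinProd_apply, Finset.abs_prod]
  refine Finset.prod_eq_one fun x _ => ?_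
  rcases Int.units_eq_one_or (η x) with h | h <;> simp [h]

theorem isCylinder_spinProd (A : Finset V) : IsCylinder (spinProd A) :=
  ⟨A, fun η η' h => Finset.prod_congr rfl fun x hx => by rw [h x hx]⟩

theorem spinProd_flip_of_notMem {A : Finset V} {x : V} (hx : x ∉ A) (η : SpinConfig V) :
    spinProd A (η.flip x) = spinProd A η := by
  refine Finset.prod_congr rfl fun y hy => ?_
  have : y ≠ x := fun h => hx (h ▸ hy)
  simp [SpinConfig.flip, this]

variable [DecidableEq V]

theorem spinProd_mul (A B : Finset V) : spinProd A * spinProd B = spinProd (symmDiff A B) := by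
  ext η
  have hd : Disjoint (symmDiff A B) (A ∩ B) := disjoint_symmDiff_inf A B
  have hu : A ∪ B = symmDiff A B ∪ (A ∩ B) := (symmDiff_sup_inf A B).symm
  have h1 : spinProd (A ∩ B) η * spinProd (A ∩ B) η = 1 := by
    rw [← abs_mul_abs_self, abs_spinProd, one_mul]
  rw [spinProd_apply] at h1
  rw [ContinuousMap.mul_apply, spinProd_apply, spinProd_apply, ← Finset.prod_union_inter, hu,
    Finset.prod_union hd, mul_assoc, h1, mul_one, spinProd_apply]

/-- The spin products are closed under multiplication and separate configurations, so the
Stone-Weierstrass theorem applies to their span. -/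
theorem topologicalClosure_span_spinProd :
    (Submodule.span ℝ (Set.range (spinProd (V := V)))).topologicalClosure = ⊤ := by
  let M : Submonoid C(SpinConfig V, ℝ) :=
    { carrier := Set.range spinProd
      one_mem' := ⟨∅, by ext; simp [spinProd_apply]⟩
      mul_mem' := by
        rintro _ _ ⟨A, rfl⟩ ⟨B, rfl⟩
        exact ⟨_, (spinProd_mul A B).symm⟩ }
  have hspan : Subalgebra.toSubmodule (Algebra.adjoin ℝ (M : Set C(SpinConfig V, ℝ))) =
      Submodule.span ℝ (Set.range spinProd) := by
    rw [Algebra.adjoin_eq_span, Submonoid.closure_eq]; rfl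
  have hsep : (Algebra.adjoin ℝ (M : Set C(SpinConfig V, ℝ))).SeparatesPoints := by
    intro η η' hne
    obtain ⟨x, hx⟩ := Function.ne_iff.1 hne
    refine ⟨spinProd {x}, ⟨spinProd {x}, Algebra.subset_adjoin ⟨_, rfl⟩, rfl⟩, ?_⟩
    simpa [spinProd_apply, Units.val_inj] using hx
  have htop := ContinuousMap.subalgebra_topologicalClosure_eq_top_of_separatesPoints _ hsep
  rw [← hspan]
  refine SetLike.coe_injective ?_
  simpa using congrArg (fun S : Subalgebra ℝ C(SpinConfig V, ℝ) => (S : Set C(SpinConfig V, ℝ))) htop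

theorem spinProd_flip_of_mem {A : Finset V} {x : V} (hx : x ∈ A) (η : SpinConfig V) :
    spinProd A (η.flip x) = -spinProd A η := by
  have h := spinProd_flip_of_notMem (Finset.notMem_erase x A) η
  rw [spinProd_apply] at h
  rw [spinProd_apply, spinProd_apply, ← Finset.mul_prod_erase A _ hx,
    ← Finset.mul_prod_erase A _ hx, h, spinProd_apply]
  simp [SpinConfig.flip]

variable (G : SimpleGraph V) [G.LocallyFinite] (sgn : G.edgeSet → ℤˣ)

/-- The signed generator of the dual system of annihilating random walks: a walker at `x ∈ A` jumps
to a uniformly chosen neighbour `y`, where it annihilates with a walker already present, and the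
sign of the traversed edge is recorded as a factor. -/
noncomputable def dualGen {E : Type*} [AddCommGroup E] [Module ℝ E] (F : Finset V → E)
    (A : Finset V) : E :=
  ∑ x ∈ A, (1 / (G.degree x : ℝ)) • ∑ y : G.neighborSet x,
    (((sgn ⟨s(x, (y : V)), G.mem_edgeSet.2 y.2⟩ : ℤ) : ℝ) • F (symmDiff A {x, (y : V)}) - F A)

theorem map_dualGen {E E' : Type*} [AddCommGroup E] [Module ℝ E] [AddCommGroup E'] [Module ℝ E']
    (L : E →ₗ[ℝ] E') (F : Finset V → E) (A : Finset V) :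
    L (dualGen G sgn F A) = dualGen G sgn (fun B => L (F B)) A := by
  simp only [dualGen, map_sum, map_smul, map_sub]

/-- Duality at the level of generators. -/
theorem Ω_spinProd (A : Finset V) : Ω G sgn (spinProd A) = dualGen G sgn spinProd A := by
  ext η
  have hL := map_dualGen G sgn (ContinuousMap.evalCLM ℝ η : C(SpinConfig V, ℝ) →L[ℝ] ℝ).toLinearMap
    spinProd A
  refine Eq.trans ?_ hL.symm
  rw [Ω, tsum_eq_sum (s := A) fun x hx => by rw [spinProd_flip_of_notMem hx]; simp, dualGen]
  refine Finset.sum_congr rfl fun x hx => ?_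
  rw [spinProd_flip_of_mem hx, flipRate, mul_left_comm, smul_eq_mul, Finset.mul_sum]
  congr 1
  refine Finset.sum_congr rfl fun y _ => ?_
  have hxy : x ≠ y := G.ne_of_adj y.2
  have hprod : spinProd {x, (y : V)} η = ((η x : ℤ) : ℝ) * ((η y : ℤ) : ℝ) :=
    Finset.prod_pair hxy
  simp only [ContinuousLinearMap.coe_coe, ContinuousMap.evalCLM_apply, ← spinProd_mul,
    ContinuousMap.mul_apply, hprod, smul_eq_mul]
  generalize sgn _ = σ
  rcases Int.units_eq_one_or (η x) with h1 | h1 <;> rcases Int.units_eq_one_or (η y) with h2 | h2 <;>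
    rcases Int.units_eq_one_or σ with h3 | h3 <;>
    simp [h1, h2, h3]

theorem card_symmDiff_pair_le {A : Finset V} {x : V} (hx : x ∈ A) (y : V) :
    (symmDiff A {x, y}).card ≤ A.card := by
  have hsub : symmDiff A {x, y} ⊆ insert y (A.erase x) := by
    intro z hz
    simp only [Finset.mem_symmDiff, Finset.mem_insert, Finset.mem_singleton,
      Finset.mem_erase] at hz ⊢
    by_cases hzx : z = x
    · subst hzx; tauto
    · tauto
  have h1 := Finset.card_le_card hsub
  have h2 := Finset.card_insert_le y (A.erase x)
  have h3 := Finset.card_erase_add_one hx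
  omega

/-- On sets of at most `n` walkers, `dualGen + n` is bounded by `n` in the supremum norm: walkers
jump at rate `1`, no walkers are created, and the signs have modulus `1`. -/
theorem abs_dualGen_add_le {n : ℕ} {F : Finset V → ℝ} {c : ℝ}
    (hF : ∀ B, B.card ≤ n → |F B| ≤ c) {A : Finset V} (hA : A.card ≤ n) :
    |dualGen G sgn F A + n * F A| ≤ n * c := by
  have hterm : ∀ x ∈ A, |(1 / (G.degree x : ℝ)) • (∑ y : G.neighborSet x,
      (((sgn ⟨s(x, (y : V)), G.mem_edgeSet.2 y.2⟩ : ℤ) : ℝ) • F (symmDiff A {x, (y : V)}) - F A))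
        + F A| ≤ c := by
    intro x hx
    -- An isolated vertex contributes `0` to the generator, by the convention `1 / 0 = 0`.
    rcases Nat.eq_zero_or_pos (G.degree x) with hd | hd
    · simpa [hd] using hF A hA
    have hd' : (0 : ℝ) < G.degree x := by exact_mod_cast hd
    rw [Finset.sum_sub_distrib, Finset.sum_const, Finset.card_univ,
      G.card_neighborSet_eq_degree, nsmul_eq_mul, smul_eq_mul, mul_sub, ← mul_assoc,
      one_div_mul_cancel hd'.ne', one_mul, sub_add_cancel, abs_mul, abs_of_pos (by positivity),
      one_div, inv_mul_le_iff₀ hd']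
    refine (Finset.abs_sum_le_sum_abs _ _).trans ?_
    refine (Finset.sum_le_card_nsmul _ _ c fun y _ => ?_).trans_eq ?_
    · have := hF _ ((card_symmDiff_pair_le hx (y : V)).trans hA)
      rcases Int.units_eq_one_or (sgn ⟨s(x, (y : V)), G.mem_edgeSet.2 y.2⟩) with h | h <;>
        simpa [h] using this
    · rw [Finset.card_univ, G.card_neighborSet_eq_degree, nsmul_eq_mul]
  have hsplit : dualGen G sgn F A + n * F A = ∑ x ∈ A, ((1 / (G.degree x : ℝ)) •
      (∑ y : G.neighborSet x, (((sgn ⟨s(x, (y : V)), G.mem_edgeSet.2 y.2⟩ : ℤ) : ℝ) •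
        F (symmDiff A {x, (y : V)}) - F A)) + F A) + ((n : ℝ) - A.card) * F A := by
    rw [Finset.sum_add_distrib, Finset.sum_const, nsmul_eq_mul, dualGen]
    ring
  have hcard : (0 : ℝ) ≤ (n : ℝ) - A.card := sub_nonneg.2 (by exact_mod_cast hA)
  rw [hsplit]
  refine (abs_add_le _ _).trans ?_
  have h1 := (Finset.abs_sum_le_sum_abs _ _).trans (Finset.sum_le_card_nsmul _ _ c hterm)
  have h2 := mul_le_mul_of_nonneg_left (hF A hA) hcard
  rw [nsmul_eq_mul] at h1
  rw [abs_mul, abs_of_nonneg hcard]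
  linarith

theorem hasDerivWithinAt_dualGen {F : Finset V → ℝ → ℝ} {F' : Finset V → ℝ} {s : Set ℝ} {t : ℝ}
    (hF : ∀ B, HasDerivWithinAt (F B) (F' B) s t) (A : Finset V) :
    HasDerivWithinAt (fun r => dualGen G sgn (fun B => F B r) A) (dualGen G sgn F' A) s t := by
  unfold dualGen
  refine HasDerivWithinAt.fun_sum fun x _ => HasDerivWithinAt.fun_const_smul _ ?_
  exact HasDerivWithinAt.fun_sum fun y _ => ((hF _).fun_const_smul _).fun_sub (hF A)

theorem continuousOn_dualGen {F : Finset V → ℝ → ℝ} {s : Set ℝ}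
    (hF : ∀ B, ContinuousOn (F B) s) (A : Finset V) :
    ContinuousOn (fun r => dualGen G sgn (fun B => F B r) A) s := by
  unfold dualGen
  fun_prop

variable {G sgn}

/-! ### Ergodicity -/

/-- The expectations `u A t` of the spin products solve the linear system `u' = dualGen u`, to which
the decay estimate applies on the sets `A` of bounded cardinality. -/
theorem IsSignedVoterModel.isAsymptoticallyInvariant_spinProd {Φ : FellerProcess (SpinConfig V)}
    [OpensMeasurableSpace (SpinConfig V)] (hΦ : IsSignedVoterModel G sgn Φ) (A : Finset V) :
    Φ.IsAsymptoticallyInvariant (spinProd A) := by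
  intro s η
  set n := A.card
  -- Starting from `spinProd A`, the system only involves sets of at most `n = |A|` elements.
  set u : Finset V → ℝ → ℝ := fun B t => Φ.semigroup t.toNNReal (spinProd B) η with hu
  set v : Finset V → ℝ → ℝ := fun B t => dualGen G sgn (fun B' => u B' t) B with hv
  set w : Finset V → ℝ → ℝ := fun B t => dualGen G sgn (fun B' => v B' t) B
  have hder : ∀ B t, 0 ≤ t → HasDerivWithinAt (u B) (v B t) (Set.Ici t) t := by
    intro B t ht
    have hgen := hΦ _ (isCylinder_spinProd B)
    rw [Ω_spinProd] at hgen
    have hL := map_dualGen G sgn ((ContinuousMap.evalCLM ℝ η :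
      C(SpinConfig V, ℝ) →L[ℝ] ℝ).toLinearMap ∘ₗ Φ.semigroup t.toNNReal) spinProd B
    exact (hgen.hasDerivWithinAt η ht).congr_deriv hL
  have hcont : ∀ B, ContinuousOn (u B) (Set.Ici 0) := fun B =>
    Φ.continuousOn_semigroup (spinProd B) η
  have hub : ∀ B t, |u B t| ≤ 1 := fun B t =>
    Φ.abs_semigroup_apply_le _ (fun y => (abs_spinProd B y).le) η
  have hvb : ∀ B t, B.card ≤ n → |v B t| ≤ 2 * n := by
    intro B t hB
    have h1 := abs_dualGen_add_le G sgn (n := n) (fun B' _ => hub B' t) hB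
    have h2 := mul_le_mul_of_nonneg_left (hub B t) n.cast_nonneg
    have h3 := abs_sub (dualGen G sgn (fun B' => u B' t) B + n * u B t) (n * u B t)
    rw [add_sub_cancel_right, abs_mul, Nat.abs_cast] at h3
    simp only [hv]
    linarith
  rw [Metric.tendsto_nhds]
  intro ε hε
  obtain ⟨T, hT0, hT⟩ := exists_forall_abs_deriv_le_of_bounded
    (ι := {B : Finset V // B.card ≤ n}) (u := fun B => u B) (v := fun B => v B)
    (w := fun B => w B) (N := n) n.cast_nonneg (fun B => hcont B)
    (fun B => continuousOn_dualGen G sgn hcont B) (fun B => hder B)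
    (fun B t ht => hasDerivWithinAt_dualGen G sgn (fun B' => hder B' t ht) B)
    (fun B => hub B) (fun B t => hvb B t B.2)
    (fun t c hc B => abs_dualGen_add_le G sgn (fun B' hB' => hc ⟨B', hB'⟩) B.2)
    (show 0 < ε / (s + 1) by positivity)
  filter_upwards [eventually_ge_atTop T.toNNReal] with t ht
  have hTt : T ≤ t := Real.toNNReal_le_iff_le_coe.1 ht
  have hs : (t : ℝ) ≤ t + s := by simp
  have hmv := norm_image_sub_le_of_norm_deriv_right_le_segment (f := u A) (f' := v A)
    (a := t) (b := t + s) (C := ε / (s + 1))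
    ((hcont A).mono fun r hr => t.2.trans hr.1)
    (fun r hr => hder A r (t.2.trans hr.1))
    (fun r hr => hT r (hTt.trans hr.1) ⟨A, le_rfl⟩) (t + s) (Set.right_mem_Icc.2 hs)
  have hlt : ε / (s + 1) * s < ε := by
    rw [div_mul_eq_mul_div, div_lt_iff₀ (by positivity)]
    linarith
  rw [Real.dist_0_eq_abs]
  rw [add_sub_cancel_left, hu] at hmv
  simp only [← NNReal.coe_add, Real.toNNReal_coe] at hmv
  exact lt_of_le_of_lt hmv hlt

end SignedVoter

theorem mainTheorem1 {V : Type*} [Countable V] (G : SimpleGraph V) [G.LocallyFinite]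
    (sgn : G.edgeSet → ℤˣ) (Φ : FellerProcess (SpinConfig V))
    (hΦ : SignedVoter.IsSignedVoterModel G sgn Φ)
    (hunique : ∃! μ : ProbabilityMeasure (SpinConfig V), Φ.IsEquilibrium μ) :
    Φ.IsErgodic := by
  classical
  refine Φ.isErgodic_of_isAsymptoticallyInvariant (fun f => ?_) hunique
  have hf : f ∈ (Submodule.span ℝ
      (Set.range (SignedVoter.spinProd (V := V)))).topologicalClosure := by
    rw [SignedVoter.topologicalClosure_span_spinProd]
    exact Submodule.mem_top
  refine FellerProcess.IsAsymptoticallyInvariant.of_mem_closure (fun g hg => ?_) hf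
  refine FellerProcess.IsAsymptoticallyInvariant.of_mem_span ?_ hg
  rintro _ ⟨A, rfl⟩
  exact hΦ.isAsymptoticallyInvariant_spinProd A
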